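/- Let $\mathbb H$ denote the quaternions, let $T\in\mathbb R$, and let $A:\mathbb R\to\mathbb H^{n\times n}$ be continuous and $T$-periodic, i.e. $A(t+T)=A(t)$ for all $t\in\mathbb R$. Let $M:\mathbb R\to\mathbb H^{n\times n}$ be a fundamental matrix of the system $\dot x=A(t)x$, $x(t)\in\mathbb H^n$; that is, the $n$ columns of $M$ are solutions on $\mathbb R$ which are right linearly independent over $\mathbb H$ (if $\alpha_1,\dots,\alpha_n\in\mathbb H$ and $x_1(t)\alpha_1+\dots+x_n(t)\alpha_n=0$ for all $t\in\mathbb{R}$, where $x_j$ are the columns, then $\alpha_1=\dots=\alpha_n=0$). Then $M(0)$ is invertible and $$M(t+T)=M(t)M^{-1}(0)M(T)\qquad\text{for all } t\in\mathbb R.$$ In addition, there are a $T$-periodic function $P:\mathbb R\to\mathbb H^{n\times n}$ and a matrix $B\in\mathbb H^{n\times n}$ such that $$e^{TB}=M^{-1}(0)M(T)\qquad\text{and}\qquad M(t)=P(t)e^{tB}\quad\text{for all } t\in\mathbb R,$$ where $e^{X}=\sum_{k\ge0}X^k/k!$ is the exponential of a quaternion matrix. -/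

import Mathlib

/-- `x : ℝ → ℍⁿ` is a solution on all of `ℝ` of the linear system `x' = A(t) x`, where the
quaternion matrix `A(t)` acts on column vectors from the left. -/
def IsQSolution {n : ℕ} (A : ℝ → Matrix (Fin n) (Fin n) (Quaternion ℝ))
    (x : ℝ → Fin n → Quaternion ℝ) : Prop :=
  ∀ t : ℝ, HasDerivAt x (Matrix.mulVec (A t) (x t)) t

/-- `M` is a fundamental matrix of `x' = A(t) x`: its `n` columns are solutions, and these
solutions are right linearly independent over `ℍ`, i.e. linearly independent in the right
`ℍ`-module of functions `ℝ → ℍⁿ` (right scalars are scalars in the opposite ring). -/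
structure IsQFundamentalMatrix {n : ℕ} (A : ℝ → Matrix (Fin n) (Fin n) (Quaternion ℝ))
    (M : ℝ → Matrix (Fin n) (Fin n) (Quaternion ℝ)) : Prop where
  col_solution : ∀ j : Fin n, IsQSolution A (fun t i => M t i j)
  col_independent :
    LinearIndependent (MulOpposite (Quaternion ℝ)) (fun (j : Fin n) (t : ℝ) (i : Fin n) => M t i j)

/-!
# Floquet's theorem for quaternionic linear systems

The two sides of the monodromy relation solve the same linear equation and agree at `0`, so they
are equal by uniqueness (`eq_zero_of_hasDerivAt_mul`). Uniqueness also makes the fundamental matrix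
invertible at each time. Everything else follows from a logarithm `L` of the monodromy matrix
`M(0)⁻¹ M(T)`: for `T ≠ 0` put `B = T⁻¹ L` and `P(t) = M(t) exp(-tB)`.

A logarithm of an invertible quaternion matrix `C` is found in two steps.

* If `C` has no negative real eigenvalue, the segment from `1` to `C` stays within the units of the
  finite-dimensional commutative algebra `ℝ[C]`. The exponentials form an open and closed subset of
  these units, so `C` is one of them (`exists_exp_eq_of_forall_neg_isUnit`).
* In general, some `J` commutes with `C`, satisfies `J³ = -J`, and is a complex structure on the
  generalized eigenspaces of the negative real eigenvalues and zero on an invariant complement, so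
  that `C (1 + 2J²)` has no negative real eigenvalue (`exists_isNegComplexStructure`). As
  `exp(πJ) = 1 + 2J²` is an involution and `J` commutes with the logarithm `L` of `C (1 + 2J²)`, it
  follows that `C = exp(L + πJ)`.

The existence of `J` is where noncommutativity of the scalars enters. On a nilpotent cyclic block
with basis `v, N v, …, N ^ k v`, let `J` multiply each basis vector by the scalar `i`; this extends
linearly over the quaternions and commutes with `N`. Fitting's lemma and an invariant complement of
a cyclic subspace of maximal length (`exists_cyclic_isCompl`) reduce the general case to this one by
induction on the dimension.
-/

/-! ### Nilpotent endomorphisms over a division ring -/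

section Nilpotent

variable {D : Type*} [DivisionRing D] {V : Type*} [AddCommGroup V] [Module D V]

/-- For a nilpotent `N` and a linear form `f` which is nonzero at `N ^ k v`, the linear forms
`f ∘ N ^ j` with `j ≤ k` detect every combination of `v, N v, …, N ^ k v`. -/
theorem coeff_eq_zero_of_forall_dual_pow {N : Module.End D V} {k : ℕ} (hN : N ^ (k + 1) = 0)
    {v : V} {f : V →ₗ[D] D} (hf : f ((N ^ k) v) ≠ 0) (c : Fin (k + 1) → D)
    (hc : ∀ j : Fin (k + 1), f ((N ^ (j : ℕ)) (∑ i, c i • (N ^ (i : ℕ)) v)) = 0) : c = 0 := by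
  suffices ∀ m (hm : m < k + 1), c ⟨m, hm⟩ = 0 from funext fun i => this i i.2
  intro m
  induction m using Nat.strong_induction_on with
  | _ m ih =>
    intro hm
    have h := hc ⟨k - m, by omega⟩
    rw [map_sum, Finset.sum_eq_single ⟨m, hm⟩] at h
    · simp only [map_smul, ← Module.End.mul_apply, ← pow_add] at h
      rw [show k - m + m = k by omega, smul_eq_mul] at h
      exact (mul_eq_zero.mp h).resolve_right hf
    · intro i _ hi
      rcases lt_or_gt_of_ne (fun e => hi (Fin.ext e) : (i : ℕ) ≠ m) with hlt | hgt
      · rw [ih i hlt i.2, zero_smul, map_zero]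
      · simp only [map_smul, ← Module.End.mul_apply, ← pow_add]
        rw [pow_eq_zero_of_le (by omega) hN]
        simp
    · simp

/-- On a nilpotent cyclic module a square root of `-1` in the scalars, applied coordinatewise in
the basis `v, N v, …, N ^ k v`, is a complex structure that commutes with `N`. -/
theorem exists_sq_eq_neg_one_of_basis {N : Module.End D V} {k : ℕ} (hN : N ^ (k + 1) = 0) {v : V}
    (b : Module.Basis (Fin (k + 1)) D V) (hb : ∀ i, b i = (N ^ (i : ℕ)) v)
    {q : D} (hq : q * q = -1) :
    ∃ I : Module.End D V, (∀ x, N (I x) = I (N x)) ∧ ∀ x, I (I x) = -x := by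
  let I : Module.End D V := b.constr ℕ (fun i => q • b i)
  have hI : ∀ i, I (b i) = q • b i := fun i => b.constr_basis ℕ _ i
  have hI' : ∀ m, I ((N ^ m) v) = q • (N ^ m) v := by
    intro m
    by_cases hm : m < k + 1
    · have := hI ⟨m, hm⟩
      rwa [hb] at this
    · rw [pow_eq_zero_of_le (by omega) hN]
      simp
  refine ⟨I, fun x => ?_, fun x => ?_⟩
  · refine LinearMap.congr_fun (f := N ∘ₗ I) (g := I ∘ₗ N) (b.ext fun i => ?_) x
    rw [LinearMap.comp_apply, LinearMap.comp_apply, hI, map_smul, hb, ← Module.End.mul_apply,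
      ← pow_succ', hI']
  · refine LinearMap.congr_fun (f := I ∘ₗ I) (g := -LinearMap.id) (b.ext fun i => ?_) x
    rw [LinearMap.comp_apply, hI, map_smul, hI, smul_smul, hq]
    simp

/-- A nonzero finite-dimensional space with a nilpotent endomorphism is the direct sum of a cyclic
subspace, generated by a vector of maximal order, and an invariant subspace. The latter is the
common kernel of the forms `f ∘ N ^ j`, for a form `f` not vanishing on the socle of the former. -/
theorem exists_cyclic_isCompl [FiniteDimensional D V] [Nontrivial V] {N : Module.End D V}
    (hN : IsNilpotent N) :
    ∃ (k : ℕ) (v : V) (U W : Submodule D V), N ^ (k + 1) = 0 ∧ IsCompl U W ∧ U ≠ ⊥ ∧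
      (∀ x ∈ U, N x ∈ U) ∧ (∀ x ∈ W, N x ∈ W) ∧
      LinearIndependent D (fun i : Fin (k + 1) => (N ^ (i : ℕ)) v) ∧
      U = Submodule.span D (Set.range fun i : Fin (k + 1) => (N ^ (i : ℕ)) v) := by
  obtain ⟨k, hk0, hk⟩ : ∃ k, N ^ (k + 1) = 0 ∧ N ^ k ≠ 0 := by
    have hpos : nilpotencyClass N ≠ 0 := by
      rw [← Nat.pos_iff_ne_zero, pos_nilpotencyClass_iff]; exact hN
    obtain ⟨k, hk⟩ := Nat.exists_eq_succ_of_ne_zero hpos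
    exact ⟨k, by simpa [hk] using pow_nilpotencyClass hN, by
      have := pow_pred_nilpotencyClass hN
      rwa [hk] at this⟩
  obtain ⟨v, hv⟩ : ∃ v, (N ^ k) v ≠ 0 := by
    by_contra! h
    exact hk (LinearMap.ext h)
  obtain ⟨f, hf, -⟩ := Submodule.exists_le_ker_of_notMem (p := (⊥ : Submodule D V))
    (v := (N ^ k) v) (by simpa using hv)
  let e : Fin (k + 1) → V := fun i => (N ^ (i : ℕ)) v
  let φ : V →ₗ[D] (Fin (k + 1) → D) := LinearMap.pi fun j => f ∘ₗ (N ^ (j : ℕ))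
  have hφ : ∀ x j, φ x j = f ((N ^ (j : ℕ)) x) := fun _ _ => rfl
  have hli : LinearIndependent D e := by
    rw [Fintype.linearIndependent_iff]
    intro c hc
    refine congrFun (coeff_eq_zero_of_forall_dual_pow hk0 hf c fun j => ?_)
    rw [show ∑ i, c i • (N ^ (i : ℕ)) v = 0 from hc, map_zero, map_zero]
  have hdisj : Disjoint (Submodule.span D (Set.range e)) φ.ker := by
    rw [Submodule.disjoint_def]
    intro x hx hxφ
    obtain ⟨c, rfl⟩ := (Submodule.mem_span_range_iff_exists_fun D).mp hx
    have : c = 0 := coeff_eq_zero_of_forall_dual_pow hk0 hf c fun j => by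
      rw [← hφ]
      exact congrFun hxφ j
    simp [this]
  refine ⟨k, v, Submodule.span D (Set.range e), φ.ker, hk0, ⟨hdisj, ?_⟩, ?_, ?_, ?_, hli, rfl⟩
  · refine codisjoint_iff.mpr (Submodule.eq_top_of_disjoint _ _ ?_ hdisj)
    have h1 := finrank_span_eq_card hli
    have h2 := φ.finrank_range_add_finrank_ker
    have h3 := Submodule.finrank_le φ.range
    rw [Module.finrank_fin_fun] at h3
    rw [Fintype.card_fin] at h1
    omega
  · intro h
    have : e (Fin.last k) ∈ (⊥ : Submodule D V) :=
      h ▸ Submodule.subset_span ⟨Fin.last k, rfl⟩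
    exact hv this
  · intro x hx
    have hle : Submodule.span D (Set.range e) ≤ (Submodule.span D (Set.range e)).comap N := by
      rw [Submodule.span_le]
      rintro _ ⟨i, rfl⟩
      change N ((N ^ (i : ℕ)) v) ∈ Submodule.span D (Set.range e)
      rw [← Module.End.mul_apply, ← pow_succ']
      by_cases hi : (i : ℕ) + 1 < k + 1
      · exact Submodule.subset_span ⟨⟨i + 1, hi⟩, rfl⟩
      · rw [pow_eq_zero_of_le (by omega) hk0]
        exact Submodule.zero_mem _
    exact hle hx
  · intro x hx
    ext j
    rw [hφ, ← Module.End.mul_apply, ← pow_succ]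
    by_cases hj : (j : ℕ) + 1 < k + 1
    · exact congrFun hx ⟨j + 1, hj⟩
    · rw [pow_eq_zero_of_le (by omega) hk0]
      simp

end Nilpotent

/-! ### Complex structures on the negative real spectrum -/

section NegativeSpectrum

variable {D : Type*} [DivisionRing D] [Algebra ℝ D]

/-- `I` is an endomorphism commuting with `C` which satisfies `I³ = -I`, so that it is zero on one
invariant summand and a complex structure on another, and the summand on which it is a complex
structure captures the negative real spectrum of `C`: after multiplication by `1 + 2I²`, which is
`1` on the first summand and `-1` on the second, no negative real eigenvalue is left. -/
structure IsNegComplexStructure {V : Type*} [AddCommGroup V] [Module D V] [Module ℝ V]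
    (C I : Module.End D V) : Prop where
  comm : ∀ v, C (I v) = I (C v)
  cube : ∀ v, I (I (I v)) = -I v
  no_neg : ∀ s : ℝ, s < 0 → ∀ v, C (v + (2 : ℝ) • I (I v)) = s • v → v = 0

variable {V : Type*} [AddCommGroup V] [Module D V] [Module ℝ V] [IsScalarTower ℝ D V]

theorem IsNegComplexStructure.exists_of_isCompl {C : Module.End D V} {U W : Submodule D V}
    (h : IsCompl U W) (hU : ∀ v ∈ U, C v ∈ U) (hW : ∀ v ∈ W, C v ∈ W)
    {IU : Module.End D U} {IW : Module.End D W}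
    (hIU : IsNegComplexStructure (C.restrict hU) IU)
    (hIW : IsNegComplexStructure (C.restrict hW) IW) :
    ∃ I : Module.End D V, IsNegComplexStructure C I := by
  let I : Module.End D V := LinearMap.ofIsCompl h (U.subtype ∘ₗ IU) (W.subtype ∘ₗ IW)
  have iu : ∀ u : U, I (u : V) = IU u := fun u => LinearMap.ofIsCompl_apply_left h u
  have iw : ∀ w : W, I (w : V) = IW w := fun w => LinearMap.ofIsCompl_apply_right h w
  have cu : ∀ u : U, C (u : V) = (C.restrict hU u : U) := fun u => rfl
  have cw : ∀ w : W, C (w : V) = (C.restrict hW w : W) := fun w => rfl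
  have dec : ∀ v : V, ∃ (u : U) (w : W), v = u + w := fun v => by
    obtain ⟨u, hu, w, hw, rfl⟩ := Submodule.codisjoint_iff_exists_add_eq.mp h.codisjoint v
    all_goals exact ⟨⟨_, ‹_›⟩, ⟨_, ‹_›⟩, rfl⟩
  refine ⟨I, fun v => ?_, fun v => ?_, fun s hs v hv => ?_⟩
  · obtain ⟨u, w, rfl⟩ := dec v
    simp only [map_add, iu, iw, cu, cw, hIU.comm, hIW.comm]
  · obtain ⟨u, w, rfl⟩ := dec v
    simp only [map_add, iu, iw, hIU.cube, hIW.cube, Submodule.coe_neg, neg_add]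
  · obtain ⟨u, w, rfl⟩ := dec v
    have e : ((C.restrict hU (u + (2 : ℝ) • IU (IU u)) - s • u : U) : V)
        = -((C.restrict hW (w + (2 : ℝ) • IW (IW w)) - s • w : W) : V) := by
      have h1 : C ((u : V) + (2 : ℝ) • I (I u)) = C.restrict hU (u + (2 : ℝ) • IU (IU u)) := by
        simp only [iu]; rfl
      have h2 : C ((w : V) + (2 : ℝ) • I (I w)) = C.restrict hW (w + (2 : ℝ) • IW (IW w)) := by
        simp only [iw]; rfl
      rw [eq_neg_iff_add_eq_zero, Submodule.coe_sub, Submodule.coe_sub, ← h1, ← h2]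
      have h3 : C ((u : V) + (2 : ℝ) • I (I u)) + C ((w : V) + (2 : ℝ) • I (I w))
          = s • ((u : V) + w) := by
        rw [← hv, ← map_add]; congr 1; simp only [map_add, smul_add]; abel
      rw [smul_add] at h3
      change C ((u : V) + (2 : ℝ) • I (I u)) - s • (u : V)
        + (C ((w : V) + (2 : ℝ) • I (I w)) - s • (w : V)) = 0
      rw [sub_add_sub_comm, h3, sub_self]
    have z := Submodule.disjoint_def.mp h.disjoint _ (Subtype.property _)
      (e ▸ W.neg_mem (Subtype.property _))
    have zU := (sub_eq_zero.mp (Submodule.coe_eq_zero.mp z))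
    rw [z, eq_comm, neg_eq_zero] at e
    have zW := (sub_eq_zero.mp (Submodule.coe_eq_zero.mp e))
    rw [hIU.no_neg s hs u zU, hIW.no_neg s hs w zW]
    simp

/-- If `C - s` is nilpotent with `s < 0`, a complex structure commuting with it is as required. -/
theorem IsNegComplexStructure.of_nilpotent {C N I : Module.End D V} {s : ℝ} (hs : s < 0)
    (hC : ∀ v, C v = s • v + N v) (hN : IsNilpotent N) (hcomm : ∀ x, N (I x) = I (N x))
    (hsq : ∀ x, I (I x) = -x) : IsNegComplexStructure C I where
  comm v := by
    rw [hC, hC, map_add, hcomm, LinearMap.map_smul_of_tower]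
  cube v := by rw [hsq]
  no_neg t ht v hv := by
    have e : N v = (-s - t) • v := by
      have : v + (2 : ℝ) • I (I v) = -v := by rw [hsq, two_smul]; abel
      rw [this, map_neg, hC] at hv
      rw [sub_smul, neg_smul, ← hv]
      abel
    obtain ⟨k, hk⟩ := hN
    have hp : ∀ m : ℕ, (N ^ m) v = (-s - t) ^ m • v := by
      intro m
      induction m with
      | zero => simp
      | succ m ih =>
        rw [pow_succ, Module.End.mul_apply, e, LinearMap.map_smul_of_tower, ih, smul_smul, pow_succ']
    have := hp k
    rw [hk, LinearMap.zero_apply, eq_comm, smul_eq_zero] at this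
    exact this.resolve_left (pow_ne_zero _ (by linarith))

universe u in
/-- The negative real spectrum is the only obstruction to a logarithm inside the real algebra
generated by `C`, and it is removed by a commuting complex structure. By Fitting's lemma and the
splitting of nilpotent endomorphisms, induction on the dimension leaves only the cyclic case. -/
theorem exists_isNegComplexStructure {q : D} (hq : q * q = -1) (d : ℕ) :
    ∀ (V : Type u) [AddCommGroup V] [Module D V] [Module ℝ V] [IsScalarTower ℝ D V]
      [FiniteDimensional D V] (_ : Module.finrank D V = d) (C : Module.End D V),
      ∃ I : Module.End D V, IsNegComplexStructure C I := by
  induction d using Nat.strong_induction_on with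
  | _ d ih =>
    intro V _ _ _ _ _ hd C
    have split : ∀ U W : Submodule D V, IsCompl U W → U ≠ ⊥ → W ≠ ⊥ → (∀ v ∈ U, C v ∈ U) →
        (∀ v ∈ W, C v ∈ W) → ∃ I : Module.End D V, IsNegComplexStructure C I := by
      intro U W h hU0 hW0 hU hW
      have hUt : U ≠ ⊤ := fun e => hW0 (by simpa [e] using h.disjoint)
      have hWt : W ≠ ⊤ := fun e => hU0 (by simpa [e] using h.disjoint)
      obtain ⟨IU, hIU⟩ := ih _ (hd ▸ Submodule.finrank_lt hUt) U rfl (C.restrict hU)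
      obtain ⟨IW, hIW⟩ := ih _ (hd ▸ Submodule.finrank_lt hWt) W rfl (C.restrict hW)
      exact IsNegComplexStructure.exists_of_isCompl h hU hW hIU hIW
    by_cases hneg : ∀ s : ℝ, s < 0 → ∀ v, C v = s • v → v = 0
    · exact ⟨0, fun v => by simp, fun v => by simp,
        fun s hs v hv => hneg s hs v (by simpa using hv)⟩
    push Not at hneg
    obtain ⟨s, hs, v, hv, hv0⟩ := hneg
    have : Nontrivial V := ⟨v, 0, hv0⟩
    let N : Module.End D V := C - algebraMap ℝ (Module.End D V) s
    have hC : ∀ x, C x = s • x + N x := fun x => by simp [N]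
    have hinv : ∀ U : Submodule D V, (∀ x ∈ U, N x ∈ U) → ∀ x ∈ U, C x ∈ U := fun U hU x hx => by
      rw [hC]
      exact U.add_mem (U.smul_of_tower_mem s hx) (hU x hx)
    have hNv : N v = 0 := by simp [N, hv]
    obtain ⟨k, hk⟩ := Filter.eventually_atTop.mp N.eventually_isCompl_ker_pow_range_pow
    -- Fitting decomposition for `N = C - s`; its first summand is nonzero as `s` is an eigenvalue.
    have hfit := hk (k + 1) (by omega)
    have hker : (N ^ (k + 1)).ker ≠ ⊥ := fun h => hv0 <| by
      rw [← Submodule.mem_bot D, ← h, LinearMap.mem_ker, pow_succ, Module.End.mul_apply, hNv,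
        map_zero]
    have hNcomm : ∀ x, (N ^ (k + 1)) (N x) = N ((N ^ (k + 1)) x) := fun x => by
      rw [← Module.End.mul_apply, ← Module.End.mul_apply, ← pow_succ, ← pow_succ']
    by_cases hran : (N ^ (k + 1)).range = ⊥
    · have hnil : IsNilpotent N := ⟨k + 1, LinearMap.range_eq_bot.mp hran⟩
      obtain ⟨m, w, U, W, hm, hUW, hU0, hU, hW, hli, hspan⟩ := exists_cyclic_isCompl hnil
      by_cases hW0 : W = ⊥
      · have hUt : U = ⊤ := by simpa [hW0] using hUW.codisjoint
        let b := Module.Basis.mk hli (by rw [← hspan, hUt])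
        obtain ⟨I, hI1, hI2⟩ := exists_sq_eq_neg_one_of_basis hm b
          (fun i => Module.Basis.mk_apply _ _ i) hq
        exact ⟨I, IsNegComplexStructure.of_nilpotent hs hC hnil hI1 hI2⟩
      · exact split U W hUW hU0 hW0 (hinv U hU) (hinv W hW)
    · refine split _ _ hfit hker hran (hinv _ fun x hx => ?_) (hinv _ fun x hx => ?_)
      · rw [LinearMap.mem_ker] at hx ⊢
        rw [hNcomm, hx, map_zero]
      · obtain ⟨y, rfl⟩ := hx
        exact ⟨N y, hNcomm y⟩

end NegativeSpectrum

/-! ### Linear equations and logarithms in normed algebras -/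

section NormedAlgebra

/-- Uniqueness for the linear equation `X' = a(t) X` in a normed ring. -/
theorem eq_zero_of_hasDerivAt_mul {R : Type*} [NormedRing R] [NormedSpace ℝ R] {a X : ℝ → R}
    (ha : Continuous a) (hX : ∀ t, HasDerivAt X (a t * X t) t) {t₀ : ℝ} (h₀ : X t₀ = 0) (t : ℝ) :
    X t = 0 := by
  obtain ⟨K, hK⟩ := (isCompact_Icc (a := min t t₀ - 1)
    (b := max t t₀ + 1)).exists_bound_of_continuousOn ha.continuousOn
  have hlip : ∀ s ∈ Set.Ioo (min t t₀ - 1) (max t t₀ + 1),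
      LipschitzOnWith K.toNNReal (fun x => a s * x) (Set.univ : Set R) := by
    intro s hs
    refine (LipschitzWith.of_dist_le_mul fun x y => ?_).lipschitzOnWith
    rw [dist_eq_norm, dist_eq_norm, ← mul_sub]
    refine (norm_mul_le _ _).trans (mul_le_mul_of_nonneg_right ?_ (norm_nonneg _))
    exact (hK s (Set.Ioo_subset_Icc_self hs)).trans (Real.le_coe_toNNReal K)
  have mem : ∀ s, min t t₀ ≤ s → s ≤ max t t₀ → s ∈ Set.Ioo (min t t₀ - 1) (max t t₀ + 1) :=
    fun s h1 h2 => ⟨by linarith, by linarith⟩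
  refine ODE_solution_unique_of_mem_Ioo (v := fun s x => a s * x) (s := fun _ => Set.univ)
    (g := fun _ => 0) hlip (mem t₀ (min_le_right _ _) (le_max_right _ _))
    (fun s _ => ⟨hX s, trivial⟩) (fun s _ => ⟨?_, trivial⟩) h₀
    (mem t (min_le_left _ _) (le_max_left _ _))
  simpa using hasDerivAt_const s (0 : R)

/-- In a complete commutative normed algebra `exp` maps neighbourhoods of `0` to neighbourhoods of
`1`, by the inverse function theorem, so its image is an open and closed subset of the units.
Hence it contains every unit joined to `1` by a path of units. -/
theorem exists_exp_eq_of_path {R : Type*} [NormedRing R] [NormedAlgebra ℝ R] [CompleteSpace R]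
    (hR : ∀ x y : R, Commute x y) {γ : unitInterval → R} (hγ : Continuous γ)
    (hu : ∀ t, IsUnit (γ t)) (h0 : γ 0 = 1) : ∃ L : R, NormedSpace.exp L = γ 1 := by
  let _ : NormedAlgebra ℚ R := NormedAlgebra.restrictScalars ℚ ℝ R
  have hadd : ∀ x y : R, NormedSpace.exp (x + y) = NormedSpace.exp x * NormedSpace.exp y :=
    fun x y => NormedSpace.exp_add_of_commute (hR x y)
  have hneg : ∀ x : R, NormedSpace.exp x * NormedSpace.exp (-x) = 1 := fun x => by
    rw [← hadd, add_neg_cancel, NormedSpace.exp_zero]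
  have hnhds : Set.range (NormedSpace.exp : R → R) ∈ nhds (1 : R) := by
    have h : HasStrictFDerivAt (NormedSpace.exp : R → R)
        ((ContinuousLinearEquiv.refl ℝ R : R ≃L[ℝ] R) : R →L[ℝ] R) 0 :=
      hasStrictFDerivAt_exp_zero (𝕂 := ℝ)
    have := h.map_nhds_eq_of_equiv
    rw [NormedSpace.exp_zero] at this
    rw [← this]
    exact Filter.range_mem_map
  -- Near `t`, the unit `γ s` differs from `γ t` by a factor close to `1`, hence by an exponential.
  have key : ∀ t, ∀ᶠ s in nhds t, ∃ L, γ s = γ t * NormedSpace.exp L := by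
    intro t
    obtain ⟨u, hut⟩ := hu t
    have hc : Continuous fun s => (↑u⁻¹ : R) * γ s := continuous_const.mul hγ
    have h1 : (↑u⁻¹ : R) * γ t = 1 := by rw [← hut, Units.inv_mul]
    have := hc.continuousAt.preimage_mem_nhds (x := t) (by rw [h1]; exact hnhds)
    filter_upwards [this] with s ⟨L, hL⟩
    exact ⟨L, by rw [hL, ← hut, Units.mul_inv_cancel_left]⟩
  have hclopen : IsClopen {t | ∃ L : R, NormedSpace.exp L = γ t} := by
    constructor
    · rw [← isOpen_compl_iff, isOpen_iff_mem_nhds]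
      intro t ht
      filter_upwards [key t] with s ⟨L, hL⟩ ⟨L', hL'⟩
      refine ht ⟨L' + -L, ?_⟩
      rw [hadd, hL', hL, mul_assoc, hneg, mul_one]
    · rw [isOpen_iff_mem_nhds]
      rintro t ⟨L', hL'⟩
      filter_upwards [key t] with s ⟨L, hL⟩
      exact ⟨L' + L, by rw [hadd, hL', hL]⟩
  have huniv := hclopen.eq_univ ⟨0, 0, by rw [NormedSpace.exp_zero, h0]⟩
  exact (huniv ▸ Set.mem_univ (1 : unitInterval) : (1 : unitInterval) ∈ {t | _})

/-- A unit whose real spectrum has no negative point has a logarithm in the real algebra generated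
by it: the segment from `1` to the unit consists of units. -/
theorem exists_exp_eq_of_forall_neg_isUnit {R : Type*} [NormedRing R] [NormedAlgebra ℝ R]
    [FiniteDimensional ℝ R] {c : R} (hc : IsUnit c)
    (hneg : ∀ s : ℝ, s < 0 → IsUnit (c - algebraMap ℝ R s)) :
    ∃ L ∈ Algebra.adjoin ℝ {c}, NormedSpace.exp L = c := by
  have : CompleteSpace R := FiniteDimensional.complete ℝ R
  let _ : NormedAlgebra ℚ R := NormedAlgebra.restrictScalars ℚ ℝ R
  let S := Algebra.adjoin ℝ {c}
  have : FiniteDimensional ℝ S := inferInstanceAs (FiniteDimensional ℝ (Subalgebra.toSubmodule S))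
  have : CompleteSpace S := FiniteDimensional.complete ℝ S
  let _ : NormedAlgebra ℚ S := NormedAlgebra.restrictScalars ℚ ℝ S
  have : IsArtinianRing S := IsArtinianRing.of_finite ℝ S
  have hcomm : ∀ x y : S, Commute x y := fun x y =>
    Subtype.ext (Algebra.commute_of_mem_adjoin_singleton_of_commute x.2
      (Algebra.commute_of_mem_adjoin_self y.2).symm).symm
  -- `S` is Artinian, so an element of `S` which is a unit of `R` is already a unit of `S`.
  have hunit : ∀ x : S, IsUnit (x : R) → IsUnit x := by
    intro x hx
    refine IsArtinianRing.isUnit_of_mem_nonZeroDivisors (mem_nonZeroDivisors_iff.mpr ⟨?_, ?_⟩)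
    · intro y hy
      exact Subtype.ext (hx.mul_right_eq_zero.mp (congrArg Subtype.val hy))
    · intro y hy
      exact Subtype.ext (hx.mul_left_eq_zero.mp (congrArg Subtype.val hy))
  let c' : S := ⟨c, Algebra.self_mem_adjoin_singleton ℝ c⟩
  let γ : unitInterval → S := fun t => (1 - (t : ℝ)) • (1 : S) + (t : ℝ) • c'
  have hγ : Continuous γ := by fun_prop
  have hu : ∀ t, IsUnit (γ t) := by
    intro t
    apply hunit
    change IsUnit ((1 - (t : ℝ)) • (1 : R) + (t : ℝ) • c)
    rcases eq_or_lt_of_le t.2.1 with h | h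
    · rw [← h]; simp
    rcases eq_or_lt_of_le t.2.2 with h1 | h1
    · rw [h1]; simpa using hc
    have e : (1 - (t : ℝ)) • (1 : R) + (t : ℝ) • c
        = (t : ℝ) • (c - algebraMap ℝ R (-((1 - (t : ℝ)) / t))) := by
      rw [smul_sub, Algebra.algebraMap_eq_smul_one, smul_smul, mul_neg, mul_div_cancel₀ _ h.ne',
        neg_smul]
      abel
    rw [e]
    exact (hneg _ (neg_lt_zero.mpr (div_pos (by linarith) h))).smul (Units.mk0 (t : ℝ) h.ne')
  obtain ⟨L, hL⟩ := exists_exp_eq_of_path hcomm hγ hu (by simp [γ])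
  refine ⟨L, L.2, ?_⟩
  have := NormedSpace.map_exp S.val continuous_subtype_val L
  change NormedSpace.exp (S.val L) = c
  rw [← this, hL]
  simp [γ, c']

/-- Euler's formula at `π`, for an element which is a direct sum of `0` and a square root of `-1`. -/
theorem exp_pi_smul_of_cube_eq_neg {R : Type*} [NormedRing R] [NormedAlgebra ℝ R]
    [CompleteSpace R] {J : R} (hJ : J * J * J = -J) :
    NormedSpace.exp (Real.pi • J) = 1 + (2 : ℝ) • (J * J) := by
  -- `1 + sin t • J + (1 - cos t) • J²` solves the equation `X' = J X` of `exp (t • J)`.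
  let X : ℝ → R := fun t =>
    NormedSpace.exp (t • J) - (1 + Real.sin t • J + (1 - Real.cos t) • (J * J))
  have hX : ∀ t, HasDerivAt X (J * X t) t := by
    intro t
    have h1 := hasDerivAt_exp_smul_const' (𝕂 := ℝ) J t
    have h2 := (Real.hasDerivAt_sin t).smul_const J
    have h3 := ((Real.hasDerivAt_cos t).const_sub 1).smul_const (J * J)
    refine (h1.sub ((h2.const_add 1).add h3)).congr_deriv ?_
    simp only [X, mul_sub, mul_add, mul_one, mul_smul_comm, ← mul_assoc, hJ]
    module
  have := eq_zero_of_hasDerivAt_mul continuous_const hX (t₀ := 0) (by simp [X]) Real.pi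
  rw [sub_eq_zero.mp this]
  simp only [Real.sin_pi, Real.cos_pi, zero_smul, add_zero]
  norm_num

end NormedAlgebra

/-! ### Quaternion matrices and fundamental matrices -/

section QuaternionMatrix

open scoped Matrix.Norms.Operator

variable {n : ℕ}

theorem isUnit_of_forall_mulVec_eq_zero {Y : Matrix (Fin n) (Fin n) (Quaternion ℝ)}
    (hY : ∀ v, Matrix.mulVec Y v = 0 → v = 0) : IsUnit Y := by
  -- Left multiplication by `Y` is injective on the finite-dimensional real algebra of matrices.
  have hinj : Function.Injective (LinearMap.mulLeft ℝ Y) := by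
    rw [← LinearMap.ker_eq_bot, LinearMap.ker_eq_bot']
    intro X hX
    ext1 i j
    refine congrFun (hY (fun i => X i j) (funext fun k => ?_)) i
    exact congrFun (congrFun hX k) j
  obtain ⟨X, hX⟩ := LinearMap.injective_iff_surjective.mp hinj 1
  exact IsUnit.of_mul_eq_one X hX

/-- A quaternion matrix as an endomorphism of the right vector space of columns. -/
def columnEnd (C : Matrix (Fin n) (Fin n) (Quaternion ℝ)) :
    Module.End (Quaternion ℝ)ᵐᵒᵖ (Fin n → Quaternion ℝ) where
  toFun := C.mulVec
  map_add' := C.mulVec_add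
  map_smul' q v := C.mulVec_smul q v

theorem exists_mulVec_eq (I : Module.End (Quaternion ℝ)ᵐᵒᵖ (Fin n → Quaternion ℝ)) :
    ∃ J : Matrix (Fin n) (Fin n) (Quaternion ℝ), ∀ v, I v = J.mulVec v := by
  refine ⟨Matrix.of fun i j => I (Pi.single j 1) i, fun v => ?_⟩
  have hv : v = ∑ j, MulOpposite.op (v j) • (Pi.single j 1 : Fin n → Quaternion ℝ) := by
    ext1 i
    simp [Finset.sum_apply, Pi.single_apply]
  conv_lhs => rw [hv]
  ext1 i
  simp [Matrix.mulVec, dotProduct, Finset.sum_apply]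

theorem eq_of_forall_mulVec_eq {X Y : Matrix (Fin n) (Fin n) (Quaternion ℝ)}
    (h : ∀ v, X.mulVec v = Y.mulVec v) : X = Y :=
  Matrix.ext_of_mulVec_single fun _ => h _

/-- Every invertible quaternion matrix has a logarithm. -/
theorem exists_exp_eq_of_isUnit {C : Matrix (Fin n) (Fin n) (Quaternion ℝ)} (hC : IsUnit C) :
    ∃ L : Matrix (Fin n) (Fin n) (Quaternion ℝ), NormedSpace.exp L = C := by
  let _ : NormedAlgebra ℚ (Matrix (Fin n) (Fin n) (Quaternion ℝ)) :=
    NormedAlgebra.restrictScalars ℚ ℝ _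
  have : FiniteDimensional (Quaternion ℝ)ᵐᵒᵖ (Fin n → Quaternion ℝ) :=
    Module.Finite.of_restrictScalars_finite ℝ _ _
  obtain ⟨q, hq⟩ : ∃ q : Quaternion ℝ, q * q = -1 := by
    refine ⟨⟨0, 1, 0, 0⟩, (QuaternionAlgebra.mk_mul_mk ..).trans ?_⟩
    apply Quaternion.ext <;> norm_num <;> rfl
  obtain ⟨I, hI⟩ := exists_isNegComplexStructure (q := MulOpposite.op q)
    (by rw [← MulOpposite.op_mul, hq, MulOpposite.op_neg, MulOpposite.op_one]) _ _ rfl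
    (columnEnd C)
  obtain ⟨J, hJ⟩ := exists_mulVec_eq I
  have hC' : ∀ v, columnEnd C v = C.mulVec v := fun _ => rfl
  have hcomm : Commute C J := eq_of_forall_mulVec_eq fun v => by
    rw [← Matrix.mulVec_mulVec, ← Matrix.mulVec_mulVec, ← hJ, ← hJ, ← hC', ← hC', hI.comm]
  have hcube : J * J * J = -J := eq_of_forall_mulVec_eq fun v => by
    rw [← Matrix.mulVec_mulVec, ← Matrix.mulVec_mulVec, Matrix.neg_mulVec, ← hJ, ← hJ, ← hJ,
      hI.cube]
  set E : Matrix (Fin n) (Fin n) (Quaternion ℝ) := 1 + (2 : ℝ) • (J * J) with hE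
  have hEE : E * E = 1 := by
    have h4 : J * J * (J * J) = -(J * J) := by rw [← mul_assoc, hcube, neg_mul]
    simp only [hE, add_mul, mul_add, one_mul, mul_one, smul_mul_smul_comm, h4]
    module
  have hEJ : Commute J E :=
    (Commute.one_right J).add_right (((Commute.refl J).mul_right (Commute.refl J)).smul_right 2)
  obtain ⟨L, hLmem, hL⟩ := exists_exp_eq_of_forall_neg_isUnit (c := C * E)
    (hC.mul (IsUnit.of_mul_eq_one E hEE)) fun s hs =>
      isUnit_of_forall_mulVec_eq_zero fun v hv => hI.no_neg s hs v <| by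
        rw [Matrix.sub_mulVec, sub_eq_zero, Algebra.algebraMap_eq_smul_one, Matrix.smul_mulVec,
          Matrix.one_mulVec, ← Matrix.mulVec_mulVec] at hv
        rw [hC', hJ, hJ, ← hv, hE, Matrix.add_mulVec, Matrix.one_mulVec, Matrix.smul_mulVec,
          ← Matrix.mulVec_mulVec]
  have hJL : Commute J L :=
    Algebra.commute_of_mem_adjoin_singleton_of_commute hLmem (hcomm.symm.mul_right hEJ)
  refine ⟨L + Real.pi • J, ?_⟩
  refine (NormedSpace.exp_add_of_commute (hJL.symm.smul_right Real.pi)).trans ?_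
  rw [hL, exp_pi_smul_of_cube_eq_neg hcube, ← hE, mul_assoc, hEE, mul_one]

variable {A M : ℝ → Matrix (Fin n) (Fin n) (Quaternion ℝ)}

theorem IsQFundamentalMatrix.hasDerivAt (hM : IsQFundamentalMatrix A M) (t : ℝ) :
    HasDerivAt M (A t * M t) t := by
  have h : HasDerivAt (fun s i j => M s i j) (fun i j => (A t * M t) i j) t :=
    hasDerivAt_pi.mpr fun i => hasDerivAt_pi.mpr fun j =>
      hasDerivAt_pi.mp (hM.col_solution j t) i
  exact h

/-- A fundamental matrix is invertible at every time: a column annihilated by `M t₀` gives a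
solution vanishing at `t₀`, hence a linear relation between the columns of `M`. -/
theorem IsQFundamentalMatrix.isUnit (hA : Continuous A) (hM : IsQFundamentalMatrix A M) (t₀ : ℝ) :
    IsUnit (M t₀) := by
  refine isUnit_of_forall_mulVec_eq_zero fun v hv => ?_
  let X : Matrix (Fin n) (Fin n) (Quaternion ℝ) := Matrix.of fun i _ => v i
  have hX : ∀ s i j, (M s * X) i j = (M s).mulVec v i := fun _ _ _ => rfl
  have h0 : M t₀ * X = 0 := by
    ext1 i j
    rw [hX, hv]
    rfl
  have hz := eq_zero_of_hasDerivAt_mul hA (X := fun t => M t * X)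
    (fun t => by simpa only [mul_assoc] using (hM.hasDerivAt t).mul_const X) h0
  have hrel := Fintype.linearIndependent_iff.mp hM.col_independent
      (fun j => MulOpposite.op (v j)) <| by
    ext1 t
    ext1 i
    have := congrFun (congrFun (hz t) i) i
    rw [hX] at this
    simpa [Matrix.mulVec, dotProduct, Finset.sum_apply] using this
  ext1 j
  simpa using hrel j

/-- `t ↦ M (t + T)` and `t ↦ M t * M(0)⁻¹ * M T` solve the same equation and agree at `0`. -/
theorem IsQFundamentalMatrix.add_period {T : ℝ} (hA : Continuous A) (hAT : Function.Periodic A T)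
    (hM : IsQFundamentalMatrix A M) (t : ℝ) :
    M (t + T) = M t * Ring.inverse (M 0) * M T := by
  have hd : ∀ t, HasDerivAt (fun t => M (t + T) - M t * (Ring.inverse (M 0) * M T))
      (A t * (M (t + T) - M t * (Ring.inverse (M 0) * M T))) t := fun t => by
    have h1 := (hM.hasDerivAt (t + T)).comp_add_const t T
    rw [hAT] at h1
    refine (h1.sub ((hM.hasDerivAt t).mul_const _)).congr_deriv ?_
    rw [mul_sub, mul_assoc]
  have := eq_zero_of_hasDerivAt_mul hA hd (t₀ := 0)
    (by rw [zero_add, ← mul_assoc, Ring.mul_inverse_cancel _ (hM.isUnit hA 0), one_mul, sub_self]) t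
  rw [sub_eq_zero.mp this, mul_assoc]

/-- If `M (t + T) = M t * exp (T B)`, then `M t * exp (-t B)` is `T`-periodic. -/
theorem periodic_mul_exp_neg {T : ℝ} {B : Matrix (Fin n) (Fin n) (Quaternion ℝ)}
    (h : ∀ t, M (t + T) = M t * NormedSpace.exp (T • B)) :
    Function.Periodic (fun t => M t * NormedSpace.exp ((-t) • B)) T ∧
      ∀ t : ℝ, M t = M t * NormedSpace.exp ((-t) • B) * NormedSpace.exp (t • B) := by
  let _ : NormedAlgebra ℚ (Matrix (Fin n) (Fin n) (Quaternion ℝ)) :=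
    NormedAlgebra.restrictScalars ℚ ℝ _
  have hadd : ∀ r s : ℝ, NormedSpace.exp (r • B) * NormedSpace.exp (s • B)
      = NormedSpace.exp ((r + s) • B) := fun r s => by
    rw [add_smul]
    exact (NormedSpace.exp_add_of_commute (((Commute.refl B).smul_left r).smul_right s)).symm
  refine ⟨fun t => ?_, fun t => ?_⟩
  · change M (t + T) * NormedSpace.exp ((-(t + T)) • B) = M t * NormedSpace.exp ((-t) • B)
    rw [h, mul_assoc, hadd, show T + -(t + T) = -t by ring]
  · rw [mul_assoc, hadd, neg_add_cancel, zero_smul, NormedSpace.exp_zero, mul_one]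

end QuaternionMatrix

theorem mainTheorem1 (n : ℕ) (T : ℝ) (A M : ℝ → Matrix (Fin n) (Fin n) (Quaternion ℝ))
    (hA : Continuous A) (hAT : Function.Periodic A T) (hM : IsQFundamentalMatrix A M) :
    IsUnit (M 0) ∧
    (∀ t : ℝ, M (t + T) = M t * Ring.inverse (M 0) * M T) ∧
    ∃ (P : ℝ → Matrix (Fin n) (Fin n) (Quaternion ℝ)) (B : Matrix (Fin n) (Fin n) (Quaternion ℝ)),
      Function.Periodic P T ∧
      NormedSpace.exp (T • B) = Ring.inverse (M 0) * M T ∧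
      ∀ t : ℝ, M t = P t * NormedSpace.exp (t • B) := by
  have hunit : ∀ t, IsUnit (M t) := hM.isUnit hA
  have hper : ∀ t : ℝ, M (t + T) = M t * Ring.inverse (M 0) * M T := hM.add_period hA hAT
  obtain ⟨B, hB⟩ : ∃ B : Matrix (Fin n) (Fin n) (Quaternion ℝ),
      NormedSpace.exp (T • B) = Ring.inverse (M 0) * M T := by
    rcases eq_or_ne T 0 with rfl | hT
    · exact ⟨0, by rw [smul_zero, NormedSpace.exp_zero, Ring.inverse_mul_cancel _ (hunit 0)]⟩
    · obtain ⟨L, hL⟩ := exists_exp_eq_of_isUnit ((hunit 0).ringInverse.mul (hunit T))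
      exact ⟨T⁻¹ • L, by rw [smul_inv_smul₀ hT]; exact hL⟩
  have hfloquet := periodic_mul_exp_neg (M := M) (T := T) (B := B) fun t => by
    rw [hper, mul_assoc]
    exact congrArg _ hB.symm
  exact ⟨hunit 0, hper, _, B, hfloquet.1, hB, hfloquet.2⟩
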